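/- Let $G$ be a group. If $B\le A$ are normal subgroups of $G$ with $A/B$ abelian, then $A/B$ is a right module over the group ring $\mathbb{Z}[G/A]$ via conjugation: $u=\sum_k m_k\,h_kA$ sends $aB$ to $\prod_k (h_k^{-1}ah_k)^{m_k}B$. A right module $T$ over a ring $R$ has no $R$-torsion if $xr=0$ with $x\in T$, $r\in R$ implies $x=0$ or $r=0$. A series of normal subgroups $$G=G_1>G_2>\dots>G_n>G_{n+1}=1$$ of $G$ (with strict inclusions) is called principal if each factor $G_i/G_{i+1}$ ($1\le i\le n$) is abelian and has no torsion as a right $\mathbb{Z}[G/G_i]$-module. A group is rigid if it has a principal series, and $n$-rigid if it is moreover solvable of class exactly $n$; the principal series of an $n$-rigid group is unique and has length $n$. The principal dimension of an $n$-rigid group $G$ is the tuple $r(G)=(r_1(G),\dots,r_n(G))$, where $r_i(G)$ is the rank of the right $\mathbb{Z}[G/G_i]$-module $G_i/G_{i+1}$, i.e. the maximal cardinality of a system of elements linearly independent over $\mathbb{Z}[G/G_i]$. **Lemma.** Let $G$ and $H$ be $n$-rigid groups, and assume that all the ranks $r_1(G),\dots,r_n(G)$ are finite (for instance, that $G$ is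 finitely generated). If $\varphi:G\to H$ is a proper epimorphism, that is, a surjective homomorphism with non-trivial kernel, then $r(G)>r(H)$ in the left lexicographical order: there is an index $i$ with $r_j(G)=r_j(H)$ for all $j<i$ and $r_i(G)>r_i(H)$. -/

import Mathlib

universe u v


/-- `A ≥ B` are subgroups of `G` such that `A / B` is abelian, that is, `[A, A] ≤ B`. -/
class IsAbelianSection {G : Type*} [Group G] (A B : Subgroup G) : Prop where
  le : B ≤ A
  commutator_le : ⁅A, A⁆ ≤ B

/-- The factor `A / B`, written additively. -/
abbrev Factor {G : Type*} [Group G] (A B : Subgroup G) : Type _ :=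
  Additive (A ⧸ B.subgroupOf A)

/-- The group ring `ℤ[G / A]`. -/
abbrev QuotientGroupRing {G : Type*} [Group G] (A : Subgroup G) [A.Normal] : Type _ :=
  MonoidAlgebra ℤ (G ⧸ A)

namespace Factor

variable {G : Type*} [Group G] (A B : Subgroup G)

instance instAddCommGroup [B.Normal] [h : IsAbelianSection A B] : AddCommGroup (Factor A B) :=
  { (inferInstance : AddGroup (Factor A B)) with
    add_comm := by
      intro x y
      induction x using Additive.rec with | _ x
      induction y using Additive.rec with | _ y
      refine congrArg Additive.ofMul ?_
      induction x using QuotientGroup.induction_on with | _ x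
      induction y using QuotientGroup.induction_on with | _ y
      refine QuotientGroup.eq.2 (Subgroup.mem_subgroupOf.2 (h.commutator_le ?_))
      have := Subgroup.commutator_mem_commutator (y⁻¹).2 (x⁻¹).2
      simpa [commutatorElement_def, mul_assoc] using this }

/-- The class in `A / B` of an element of `A`. -/
def mk (a : A) : Factor A B := Additive.ofMul (QuotientGroup.mk a)

theorem mk_eq_zero [B.Normal] [IsAbelianSection A B] (a : A) :
    mk A B a = 0 ↔ (a : G) ∈ B := by
  change (QuotientGroup.mk a : A ⧸ B.subgroupOf A) = 1 ↔ _
  rw [QuotientGroup.eq_one_iff, Subgroup.mem_subgroupOf]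

/-- Conjugation `a ↦ g⁻¹ a g` on `A / B`. -/
def conj [A.Normal] [B.Normal] [IsAbelianSection A B] (g : G) : AddMonoid.End (Factor A B) :=
  MonoidHom.toAdditive (QuotientGroup.map (B.subgroupOf A) (B.subgroupOf A)
    (MulAut.conjNormal g⁻¹ : MulAut A).toMonoidHom (by
      intro a ha
      have h := (inferInstance : B.Normal).conj_mem _ (Subgroup.mem_subgroupOf.1 ha) g⁻¹
      simpa [Subgroup.mem_subgroupOf] using h))

theorem conj_mk [A.Normal] [B.Normal] [IsAbelianSection A B] (g : G) (a : A) :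
    conj A B g (mk A B a) = mk A B (MulAut.conjNormal g⁻¹ a) := rfl

theorem end_ext [B.Normal] [IsAbelianSection A B] {f f' : AddMonoid.End (Factor A B)}
    (h : ∀ a, f (mk A B a) = f' (mk A B a)) : f = f' := by
  refine AddMonoidHom.ext fun x => ?_
  induction x using Additive.rec with | _ x
  induction x using QuotientGroup.induction_on with | _ x
  exact h x

/-- The right action of `G / A` on `A / B` by conjugation. -/
def conjHom [A.Normal] [B.Normal] [h : IsAbelianSection A B] :
    G ⧸ A →* (AddMonoid.End (Factor A B))ᵐᵒᵖ :=
  QuotientGroup.lift A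
    { toFun := fun g => MulOpposite.op (conj A B g)
      map_one' := by
        refine congrArg MulOpposite.op (end_ext A B fun a => ?_)
        rw [conj_mk]
        simp
      map_mul' := by
        intro g g'
        refine congrArg MulOpposite.op (end_ext A B fun a => ?_)
        change _ = conj A B g' (conj A B g (mk A B a))
        rw [conj_mk, conj_mk, conj_mk]
        simp }
    (by
      intro g hg
      refine congrArg MulOpposite.op (end_ext A B fun a => ?_)
      rw [conj_mk]
      refine congrArg Additive.ofMul (QuotientGroup.eq.2 (Subgroup.mem_subgroupOf.2
        (h.commutator_le ?_)))
      have := Subgroup.commutator_mem_commutator (A.inv_mem hg) (A.inv_mem a.2)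
      simpa [commutatorElement_def, mul_assoc] using this)

/-- `A / B` as a right `ℤ[G / A]`-module, that is, a left module over the opposite ring:
`u = ∑ mₖ (hₖ A)` sends `a B` to `∏ (hₖ⁻¹ a hₖ)^{mₖ} B`. -/
noncomputable instance instModule [A.Normal] [B.Normal] [IsAbelianSection A B] :
    Module (QuotientGroupRing A)ᵐᵒᵖ (Factor A B) :=
  Module.compHom (Factor A B)
    ((RingEquiv.opOp (AddMonoid.End (Factor A B))).symm.toRingHom.comp
      (RingHom.op (MonoidAlgebra.lift ℤ (AddMonoid.End (Factor A B))ᵐᵒᵖ (G ⧸ A)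
        (conjHom A B)).toRingHom))

theorem single_smul_mk [A.Normal] [B.Normal] [IsAbelianSection A B] (g : G) (m : ℤ) (a : A) :
    MulOpposite.op (MonoidAlgebra.single (g : G ⧸ A) m : QuotientGroupRing A) • mk A B a =
      m • mk A B (MulAut.conjNormal g⁻¹ a) := by
  change MulOpposite.unop (MonoidAlgebra.lift ℤ (AddMonoid.End (Factor A B))ᵐᵒᵖ (G ⧸ A)
        (conjHom A B) (MonoidAlgebra.single (g : G ⧸ A) m)) (mk A B a) = _
  rw [MonoidAlgebra.lift_single]
  rfl

/-- `A / B` has no torsion as a right `ℤ[G / A]`-module. -/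
def NoTorsion [A.Normal] [B.Normal] [IsAbelianSection A B] : Prop :=
  ∀ (x : Factor A B) (u : QuotientGroupRing A), MulOpposite.op u • x = 0 → u = 0 ∨ x = 0

theorem NoTorsion.commutator_notMem {A B : Subgroup G} [A.Normal] [B.Normal] [IsAbelianSection A B]
    (h : NoTorsion A B) {a b : G} (ha : a ∉ A) (hb : b ∈ A) (hb' : b ∉ B) :
    b⁻¹ * (a⁻¹ * b * a) ∉ B := by
  intro hc
  have key : MulOpposite.op (MonoidAlgebra.single (a : G ⧸ A) 1 -
      MonoidAlgebra.single ((1 : G) : G ⧸ A) 1 : QuotientGroupRing A) • mk A B ⟨b, hb⟩ = 0 := by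
    rw [MulOpposite.op_sub, sub_smul, single_smul_mk, single_smul_mk, one_smul, one_smul,
      sub_eq_zero]
    refine congrArg Additive.ofMul (Eq.symm (QuotientGroup.eq.2 (Subgroup.mem_subgroupOf.2 ?_)))
    simpa [mul_assoc] using hc
  rcases h _ _ key with h0 | h0
  · rw [sub_eq_zero] at h0
    have h1 := (Finsupp.single_left_inj (one_ne_zero (α := ℤ))).1
      (congrArg (fun u : MonoidAlgebra ℤ (G ⧸ A) => u.coeff) h0)
    exact ha ((QuotientGroup.eq_one_iff a).1 h1)
  · exact hb' ((mk_eq_zero A B _).1 h0)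

/-- The rank of `A / B` as a right `ℤ[G / A]`-module: the supremum of the cardinalities of its
linearly independent subsets. -/
noncomputable def rank [A.Normal] [B.Normal] [IsAbelianSection A B] : Cardinal :=
  Module.rank (QuotientGroupRing A)ᵐᵒᵖ (Factor A B)

end Factor

/-- A principal series `G = G₁ > G₂ > ⋯ > Gₙ > Gₙ₊₁ = 1` of length `n`.
The subgroup `Gᵢ₊₁` is `term i`, for `i = 0, …, n`. -/
structure PrincipalSeries (G : Type*) [Group G] (n : ℕ) where
  term : Fin (n + 1) → Subgroup G
  term_zero : term 0 = ⊤
  term_last : term (Fin.last n) = ⊥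
  strictAnti : StrictAnti term
  [normal : ∀ i, (term i).Normal]
  [abelian : ∀ i : Fin n, IsAbelianSection (term i.castSucc) (term i.succ)]
  noTorsion : ∀ i : Fin n, Factor.NoTorsion (term i.castSucc) (term i.succ)

attribute [instance] PrincipalSeries.normal PrincipalSeries.abelian

/-- A group is rigid if it has a principal series. -/
def IsRigid (G : Type*) [Group G] : Prop := ∃ n, Nonempty (PrincipalSeries G n)

/-- `G` is solvable of class exactly `n`. -/
def IsSolvableOfClass (G : Type*) [Group G] (n : ℕ) : Prop :=
  derivedSeries G n = ⊥ ∧ ∀ m < n, derivedSeries G m ≠ ⊥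

/-- The `n`-rigid groups are the rigid groups that are solvable of class `n`. -/
def IsNRigid (G : Type*) [Group G] (n : ℕ) : Prop := IsRigid G ∧ IsSolvableOfClass G n

namespace PrincipalSeries

variable {G : Type*} [Group G] {n : ℕ} (S : PrincipalSeries G n)

/-- The tuple `(r₁, …, rₙ)`, where `rᵢ` is the rank of `Gᵢ / Gᵢ₊₁` over `ℤ[G / Gᵢ]`. -/
noncomputable def dimension (i : Fin n) : Cardinal :=
  Factor.rank (S.term i.castSucc) (S.term i.succ)

theorem derivedSeries_le (i : Fin (n + 1)) : derivedSeries G i ≤ S.term i := by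
  induction i using Fin.induction with
  | zero => simp [S.term_zero]
  | succ i ih =>
    rw [Fin.val_succ, derivedSeries_succ]
    exact (Subgroup.commutator_mono ih ih).trans (S.abelian i).commutator_le

theorem not_derivedSeries_le (k : ℕ) (hk : k < n) :
    ¬ derivedSeries G k ≤ S.term (Fin.succ ⟨k, hk⟩) := by
  induction k with
  | zero =>
    intro h
    rw [derivedSeries_zero, ← S.term_zero] at h
    exact absurd h (S.strictAnti (Fin.succ_pos _)).not_ge
  | succ k ih =>
    intro h
    obtain ⟨a, ha, ha'⟩ := SetLike.not_le_iff_exists.1 (ih (by omega))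
    have hlt := S.strictAnti (Fin.castSucc_lt_succ (i := (⟨k + 1, hk⟩ : Fin n)))
    obtain ⟨b, hb, hb'⟩ := SetLike.exists_of_lt hlt
    have ht := S.noTorsion ⟨k + 1, hk⟩
    have hc := ht.commutator_notMem ha' hb hb'
    have hcA : b⁻¹ * (a⁻¹ * b * a) ∈ S.term (Fin.castSucc ⟨k + 1, hk⟩) := by
      refine mul_mem (inv_mem hb) ?_
      simpa using (S.normal _).conj_mem b hb a⁻¹
    have hcD : b⁻¹ * (a⁻¹ * b * a) ∈ derivedSeries G k := by
      have h1 := (derivedSeries_normal G k).conj_mem a⁻¹ (inv_mem ha) b⁻¹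
      simpa [mul_assoc] using mul_mem h1 ha
    have hd := ht.commutator_notMem ha' hcA hc
    refine hd (h ?_)
    rw [derivedSeries_succ]
    have h2 := Subgroup.commutator_mem_commutator (inv_mem hcD) (inv_mem ha)
    rw [commutatorElement_def, inv_inv, inv_inv] at h2
    rw [← mul_assoc, ← mul_assoc]
    exact h2

/-- The length of a principal series is the solvability class of the group. -/
theorem length_eq (S : PrincipalSeries G n) {m : ℕ} (h : IsSolvableOfClass G m) : n = m := by
  rcases lt_trichotomy n m with hlt | heq | hlt
  · refine absurd ?_ (h.2 n hlt)
    have := S.derivedSeries_le (Fin.last n)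
    rwa [S.term_last, le_bot_iff] at this
  · exact heq
  · refine absurd ?_ (S.not_derivedSeries_le m hlt)
    rw [h.1]
    exact bot_le

theorem mem_term_iff (i : Fin n) (x : G) :
    x ∈ S.term i.castSucc ↔ ∀ g ∈ derivedSeries G i, g⁻¹ * (x⁻¹ * g * x) ∈ S.term i.succ := by
  constructor
  · intro hx g hg
    have hg' : g ∈ S.term i.castSucc := S.derivedSeries_le i.castSucc hg
    have h := Subgroup.commutator_mem_commutator (inv_mem hg') (inv_mem hx)
    rw [commutatorElement_def, inv_inv, inv_inv] at h
    rw [← mul_assoc, ← mul_assoc]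
    exact (S.abelian i).commutator_le h
  · intro h
    by_contra hx
    obtain ⟨g, hg, hg'⟩ := SetLike.not_le_iff_exists.1 (S.not_derivedSeries_le i i.2)
    exact (S.noTorsion i).commutator_notMem hx (S.derivedSeries_le i.castSucc hg) hg' (h g hg)

/-- A principal series of given length is unique. -/
instance instSubsingleton : Subsingleton (PrincipalSeries G n) := by
  refine ⟨fun S T => ?_⟩
  have key : ∀ i, S.term i = T.term i := by
    intro i
    induction i using Fin.reverseInduction with
    | last => rw [S.term_last, T.term_last]
    | cast i ih =>
      ext x
      rw [S.mem_term_iff, T.mem_term_iff, ih]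
  obtain ⟨s, _, _, _, _⟩ := S
  obtain ⟨t, _, _, _, _⟩ := T
  obtain rfl : s = t := funext key
  rfl

end PrincipalSeries

namespace IsNRigid

variable {G : Type*} [Group G] {n : ℕ}

theorem nonempty_principalSeries (h : IsNRigid G n) : Nonempty (PrincipalSeries G n) := by
  obtain ⟨⟨m, ⟨S⟩⟩, hc⟩ := h
  obtain rfl := S.length_eq hc
  exact ⟨S⟩

/-- The principal series of an `n`-rigid group (it is the only one). -/
noncomputable def principalSeries (h : IsNRigid G n) : PrincipalSeries G n :=
  h.nonempty_principalSeries.some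

/-- The principal dimension `r(G) = (r₁(G), …, rₙ(G))` of an `n`-rigid group. -/
noncomputable def principalDimension (h : IsNRigid G n) : Fin n → Cardinal :=
  h.principalSeries.dimension

theorem principalDimension_eq (h : IsNRigid G n) (S : PrincipalSeries G n) :
    h.principalDimension = S.dimension := by
  rw [Subsingleton.elim S h.principalSeries, principalDimension]

end IsNRigid

/-! By `PrincipalSeries.mem_term_iff`, `x` lies in `Gᵢ` iff its commutators with the derived
subgroup `G⁽ⁱ⁻¹⁾` lie in `Gᵢ₊₁`. An epimorphism carries derived series onto derived series, so
descending induction gives `φ(Gᵢ) ≤ Hᵢ` (`term_le_comap`). Since `ker φ ≠ 1`, there is a first `i`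
with `Gᵢ₊₁ < φ⁻¹(Hᵢ₊₁)`.

Before `i`, `φ` identifies the factors and their group rings, so the ranks agree (`lift_rank_eq`).
At `i` the rings still agree, but `Gᵢ/Gᵢ₊₁ → Hᵢ/Hᵢ₊₁` is onto with non-zero kernel. That kernel has
positive rank, by absence of torsion, so the finite rank drops (`lift_rank_lt`). -/

namespace Factor

/-! ### Maps of factors induced by an epimorphism -/

section Comparison

variable {G : Type u} {H : Type v} [Group G] [Group H] (φ : G →* H)
  {A B : Subgroup G} {C D : Subgroup H}

/-- The homomorphism `A / B → C / D` induced by a homomorphism `φ` with `φ(A) ≤ C`, `φ(B) ≤ D`. -/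
def map [B.Normal] [IsAbelianSection A B] [D.Normal] [IsAbelianSection C D]
    (hA : A ≤ C.comap φ) (hB : B ≤ D.comap φ) : Factor A B →+ Factor C D :=
  MonoidHom.toAdditive (QuotientGroup.map (B.subgroupOf A) (D.subgroupOf C)
    ((φ.comp A.subtype).codRestrict C fun a => hA a.2) fun _ ha =>
      Subgroup.mem_subgroupOf.2 (hB (Subgroup.mem_subgroupOf.1 ha)))

theorem map_mk [B.Normal] [IsAbelianSection A B] [D.Normal] [IsAbelianSection C D]
    (hA : A ≤ C.comap φ) (hB : B ≤ D.comap φ) (a : A) :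
    map φ hA hB (mk A B a) = mk C D ⟨φ a, hA a.2⟩ := rfl

theorem mk_surjective (A B : Subgroup G) : Function.Surjective (mk A B) :=
  QuotientGroup.mk_surjective

theorem map_surjective [B.Normal] [IsAbelianSection A B] [D.Normal] [IsAbelianSection C D]
    (hφ : Function.Surjective φ) (hA : A = C.comap φ) (hB : B ≤ D.comap φ) :
    Function.Surjective (map φ hA.le hB) := by
  intro y
  obtain ⟨⟨c, hc⟩, rfl⟩ := mk_surjective C D y
  obtain ⟨g, rfl⟩ := hφ c
  exact ⟨mk A B ⟨g, hA.ge hc⟩, rfl⟩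

theorem map_mk_eq_zero [B.Normal] [IsAbelianSection A B] [D.Normal] [IsAbelianSection C D]
    (hA : A ≤ C.comap φ) (hB : B ≤ D.comap φ) (a : A) :
    map φ hA hB (mk A B a) = 0 ↔ φ a ∈ D := by
  rw [map_mk, mk_eq_zero]

variable [A.Normal] [B.Normal] [C.Normal] [D.Normal] [IsAbelianSection A B] [IsAbelianSection C D]

/-- The homomorphism `ℤ[G / A]ᵐᵒᵖ → ℤ[H / C]ᵐᵒᵖ` induced by `φ`. -/
noncomputable def ringMap (hA : A ≤ C.comap φ) :
    (QuotientGroupRing A)ᵐᵒᵖ →+* (QuotientGroupRing C)ᵐᵒᵖ :=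
  RingHom.op (MonoidAlgebra.mapDomainRingHom ℤ (QuotientGroup.map A C φ hA))

theorem ringMap_op_single (hA : A ≤ C.comap φ) (g : G) (m : ℤ) :
    ringMap φ hA (MulOpposite.op (MonoidAlgebra.single (g : G ⧸ A) m)) =
      MulOpposite.op (MonoidAlgebra.single (φ g : H ⧸ C) m) := by
  simp [ringMap]

theorem ringMap_bijective (hφ : Function.Surjective φ) (hA : A = C.comap φ) :
    Function.Bijective (ringMap φ hA.le) := by
  have hq : Function.Bijective (QuotientGroup.map A C φ hA.le) := by
    constructor
    · rw [injective_iff_map_eq_one]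
      intro x
      induction x using QuotientGroup.induction_on with | _ x
      rw [QuotientGroup.map_mk, QuotientGroup.eq_one_iff, QuotientGroup.eq_one_iff]
      exact fun hx => hA.ge hx
    · exact QuotientGroup.map_surjective_of_surjective _ _ _
        (QuotientGroup.mk_surjective.comp hφ) _
  exact (MulOpposite.opEquiv.bijective.comp
    (MonoidAlgebra.mapDomainRingEquiv ℤ (MulEquiv.ofBijective _ hq)).bijective).comp
      MulOpposite.opEquiv.symm.bijective

/-- Both sides are additive in `r`, and for a single group element the claim is that `φ` commutes
with conjugation. -/
theorem map_smul (hA : A ≤ C.comap φ) (hB : B ≤ D.comap φ) (r : (QuotientGroupRing A)ᵐᵒᵖ)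
    (x : Factor A B) : map φ hA hB (r • x) = ringMap φ hA r • map φ hA hB x := by
  induction r using MulOpposite.rec' with | _ r
  induction r using MonoidAlgebra.induction_linear with
  | zero => simp
  | add r s hr hs => rw [MulOpposite.op_add, add_smul, map_add, hr, hs, map_add, add_smul]
  | single g m =>
    induction g using QuotientGroup.induction_on with | _ g
    obtain ⟨a, rfl⟩ := mk_surjective A B x
    rw [ringMap_op_single, single_smul_mk, map_zsmul, map_mk, map_mk, single_smul_mk]
    congr 3
    simp [ConjAct.smul_def]

/-- The kernel of the map `A / B → C / D` as a submodule. -/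
noncomputable def mapKer (hA : A ≤ C.comap φ) (hB : B ≤ D.comap φ) :
    Submodule (QuotientGroupRing A)ᵐᵒᵖ (Factor A B) where
  __ := (map φ hA hB).ker
  smul_mem' r x hx := by
    change map φ hA hB (r • x) = 0
    rw [map_smul, show map φ hA hB x = 0 from hx, smul_zero]

/-- First isomorphism theorem, semilinear over the ring isomorphism `ringMap`. -/
theorem lift_rank_quotient_mapKer (hφ : Function.Surjective φ) (hA : A = C.comap φ)
    (hB : B ≤ D.comap φ) :
    Cardinal.lift.{v} (Module.rank (QuotientGroupRing A)ᵐᵒᵖ (Factor A B ⧸ mapKer φ hA.le hB)) =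
      Cardinal.lift.{u} (rank C D) := by
  refine lift_rank_eq_of_equiv_equiv (ringMap φ hA.le)
    (QuotientAddGroup.quotientKerEquivOfSurjective _ (map_surjective φ hφ hA hB))
    (ringMap_bijective φ hφ hA) fun r x => ?_
  obtain ⟨x, rfl⟩ := Submodule.Quotient.mk_surjective _ x
  exact map_smul φ hA.le hB r x

theorem lift_rank_eq (hφ : Function.Surjective φ) (hA : A = C.comap φ) (hB : B = D.comap φ) :
    Cardinal.lift.{u} (rank C D) = Cardinal.lift.{v} (rank A B) := by
  have hinj : Function.Injective (map φ hA.le hB.le) := by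
    rw [injective_iff_map_eq_zero]
    intro x hx
    obtain ⟨a, rfl⟩ := mk_surjective A B x
    exact (mk_eq_zero A B a).2 (hB.ge ((map_mk_eq_zero φ hA.le hB.le a).1 hx))
  exact (lift_rank_eq_of_equiv_equiv (ringMap φ hA.le)
    (AddEquiv.ofBijective _ ⟨hinj, map_surjective φ hφ hA hB.le⟩)
    (ringMap_bijective φ hφ hA) (map_smul φ hA.le hB.le)).symm

/-- Rank of quotient plus rank of kernel is at most the total rank over these group rings, without
any Ore condition. It remains to see that the kernel has rank at least one. -/
theorem lift_rank_lt (hφ : Function.Surjective φ) (hA : A = C.comap φ) (hB : B < D.comap φ)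
    (hD : D ≤ C) (ht : NoTorsion A B) (hfin : rank A B < Cardinal.aleph0) :
    Cardinal.lift.{u} (rank C D) < Cardinal.lift.{v} (rank A B) := by
  rw [← lift_rank_quotient_mapKer φ hφ hA hB.le, Cardinal.lift_lt]
  have hle := rank_quotient_add_rank_le (mapKer φ hA.le hB.le)
  have hne : Module.rank (QuotientGroupRing A)ᵐᵒᵖ (mapKer φ hA.le hB.le) ≠ 0 := by
    intro h0
    obtain ⟨b, hbD, hbB⟩ := SetLike.exists_of_lt hB
    have hb : b ∈ A := hA.ge (hD hbD)
    -- Rank zero would give the non-zero class of `b` a non-zero annihilator.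
    obtain ⟨r, hr, hrb⟩ := rank_eq_zero_iff.1 h0
      ⟨mk A B ⟨b, hb⟩, (map_mk_eq_zero φ hA.le hB.le ⟨b, hb⟩).2 hbD⟩
    rcases ht _ r.unop (congrArg Subtype.val hrb) with h | h
    · exact hr (MulOpposite.unop_injective h)
    · exact hbB ((mk_eq_zero A B _).1 h)
  change _ < rank A B
  change _ ≤ rank A B at hle
  -- Finiteness is essential here: the inequality is strict only after passing to natural numbers.
  obtain ⟨c, hc⟩ := Cardinal.lt_aleph0.1 hfin
  rw [hc] at hle ⊢
  obtain ⟨a, ha⟩ := Cardinal.lt_aleph0.1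
    ((self_le_add_right _ _).trans_lt (hle.trans_lt Cardinal.natCast_lt_aleph0))
  obtain ⟨b, hb⟩ := Cardinal.lt_aleph0.1
    ((self_le_add_left _ _).trans_lt (hle.trans_lt Cardinal.natCast_lt_aleph0))
  rw [ha, hb] at hle
  rw [hb] at hne
  rw [ha]
  norm_cast at hle hne ⊢
  omega

end Comparison

end Factor

/-! ### Comparison of the two principal series -/

namespace PrincipalSeries

variable {G : Type u} {H : Type v} [Group G] [Group H] {n : ℕ}

/-- An epimorphism between groups with principal series of the same length maps each term of the
first series into the corresponding term of the second. -/
theorem term_le_comap (S : PrincipalSeries G n) (T : PrincipalSeries H n) (φ : G →* H)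
    (hφ : Function.Surjective φ) (i : Fin (n + 1)) : S.term i ≤ (T.term i).comap φ := by
  induction i using Fin.reverseInduction with
  | last => rw [S.term_last]; exact bot_le
  | cast i ih =>
    intro x hx
    rw [Subgroup.mem_comap, T.mem_term_iff]
    intro h hh
    -- Surjectivity lets each `h` in the derived subgroup of `H` be lifted to `g` in that of `G`.
    rw [← map_derivedSeries_eq hφ] at hh
    obtain ⟨g, hg, rfl⟩ := hh
    simpa using ih ((S.mem_term_iff i x).1 hx g hg)

/-- The first index at which the preimage of the second series leaves the first one. -/
theorem exists_first_term_lt_comap (S : PrincipalSeries G n) (T : PrincipalSeries H n) (φ : G →* H)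
    (hφ : Function.Surjective φ) (hker : φ.ker ≠ ⊥) :
    ∃ i : Fin n, (∀ j ≤ i.castSucc, S.term j = (T.term j).comap φ) ∧
      S.term i.succ < (T.term i.succ).comap φ := by
  have hlast : S.term (Fin.last n) ≠ (T.term (Fin.last n)).comap φ := by
    rw [S.term_last, T.term_last, MonoidHom.comap_bot]
    exact hker.symm
  obtain ⟨k, hk, hmin⟩ := WellFounded.has_min (wellFounded_lt (α := Fin (n + 1)))
    {k | S.term k ≠ (T.term k).comap φ} ⟨_, hlast⟩
  induction k using Fin.cases with
  -- Both series start at the whole group, so the first discrepancy is a successor.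
  | zero => exact absurd (by rw [S.term_zero, T.term_zero, Subgroup.comap_top]) hk
  | succ i =>
    refine ⟨i, fun j hj => ?_, lt_of_le_of_ne (S.term_le_comap T φ hφ _) hk⟩
    by_contra hne
    exact hmin j hne (hj.trans_lt Fin.castSucc_lt_succ)

end PrincipalSeries

theorem mainTheorem6 {G : Type u} {H : Type v} [Group G] [Group H] {n : ℕ}
    (hG : IsNRigid G n) (hH : IsNRigid H n)
    (hfin : ∀ i, hG.principalDimension i < Cardinal.aleph0)
    (φ : G →* H) (hφ : Function.Surjective φ) (hker : φ.ker ≠ ⊥) :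
    toLex (fun i => Cardinal.lift.{u} (hH.principalDimension i)) <
      toLex (fun i => Cardinal.lift.{v} (hG.principalDimension i)) := by
  obtain ⟨i, heq, hlt⟩ :=
    hG.principalSeries.exists_first_term_lt_comap hH.principalSeries φ hφ hker
  refine ⟨i, fun j hj => ?_, ?_⟩
  -- For `j < i` the lower end `j.succ` of the factor is still at most `i.castSucc`, so both ends
  -- are full preimages.
  · exact Factor.lift_rank_eq φ hφ (heq _ (Fin.castSucc_le_castSucc_iff.2 hj.le))
      (heq _ (Fin.succ_le_castSucc_iff.2 hj))
  · exact Factor.lift_rank_lt φ hφ (heq _ le_rfl) hlt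
      (hH.principalSeries.abelian i).le (hG.principalSeries.noTorsion i) (hfin i)
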